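/- Let $\Gamma$ be a finite simplicial graph with vertex set $V$ whose edges $e$ are labelled by positive even integers $m_e$. Its Artin group is $$A_\Gamma=\langle V \mid \langle v,w\rangle^{m_e}=\langle w,v\rangle^{m_e}\text{ for every edge } e=\{v,w\}\rangle,$$ where $\langle v,w\rangle^{m}=vwv\cdots$ is the alternating product of length $m$ starting with $v$, and its Coxeter group $W_\Gamma$ is the quotient of $A_\Gamma$ by the relations $v^2=1$ for all $v\in V$. For $T\subseteq V$ let $\Gamma_T$ be the full labelled subgraph of $\Gamma$ spanned by $T$ and $A_T$ the subgroup of $A_\Gamma$ generated by $T$. A set $T\subseteq V$ is called a clique if any two distinct elements of $T$ are joined by an edge. $A_\Gamma$ is said to be of FC-type if $W_{\Gamma_T}$ is finite for every clique $T$. A group $G$ is poly-free if it has a finite chain of subgroups $1=G_0\unlhd G_1\unlhd\cdots\unlhd G_n=G$ such that each $G_i/G_{i-1}$ is a free group (of possibly infinite rank), and normally poly-free if the chain can be chosen such that moreover each $G_i$ is normal in $G$. (1) If $A_\Gamma$ is of FC-type, then $A_\Gamma$ is normally poly-free. (2) If $A_T$ is poly-free for every clique $T$ of $\Gamma$, then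 $A_\Gamma$ is poly-free. (3) If $A_T$ is normally poly-free for every clique $T$ of $\Gamma$, then $A_\Gamma$ is normally poly-free. -/

import Mathlib

/-- A simplicial graph (no loops, no multiple edges) with vertex set `V` whose edges are labelled by
integers `≥ 2`. Only the values of `label` on edges matter. -/
structure LabelledGraph (V : Type*) where
  /-- The underlying simplicial graph. -/
  graph : SimpleGraph V
  /-- The label of an edge (irrelevant for pairs that are not edges). -/
  label : Sym2 V → ℕ
  two_le_label : ∀ e ∈ graph.edgeSet, 2 ≤ label e

/-- The alternating product `v * w * v * ⋯` with `m` factors, starting with `v`. -/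
def altProd {M : Type*} [Monoid M] : ℕ → M → M → M
  | 0, _, _ => 1
  | m + 1, v, w => v * altProd m w v

namespace LabelledGraph

variable {V : Type*} (Γ : LabelledGraph V)

/-- All edge labels are even. -/
def IsEven : Prop := ∀ e ∈ Γ.graph.edgeSet, Even (Γ.label e)

/-- The relators of the Artin group: the relation `vwv⋯ = wvw⋯` (both sides of length the label of
the edge) for every edge with endpoints `v` and `w`. -/
def artinRels : Set (FreeGroup V) :=
  {r | ∃ v w : V, Γ.graph.Adj v w ∧
    r = altProd (Γ.label s(v, w)) (FreeGroup.of v) (FreeGroup.of w) *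
      (altProd (Γ.label s(v, w)) (FreeGroup.of w) (FreeGroup.of v))⁻¹}

/-- The Artin group `A_Γ`. -/
abbrev ArtinGroup : Type _ := PresentedGroup Γ.artinRels

/-- The subgroup `A_T` of `A_Γ` generated by a set `T` of vertices. -/
def artinSubgroup (T : Set V) : Subgroup Γ.ArtinGroup :=
  Subgroup.closure ((fun v : V => (PresentedGroup.of v : Γ.ArtinGroup)) '' T)

/-- The full labelled subgraph `Γ_T` spanned by a set `T` of vertices. -/
def induce (T : Set V) : LabelledGraph T where
  graph := Γ.graph.induce T
  label e := Γ.label (e.map Subtype.val)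
  two_le_label := by
    intro e
    induction e using Sym2.ind with
    | _ v w => exact fun h => Γ.two_le_label s(v.1, w.1) h

open Classical in
/-- The Coxeter matrix of `Γ`: `1` on the diagonal, the label at an edge, and `0` (which stands for
`∞`, that is, for no relation) at a pair of distinct vertices that are not joined by an edge. -/
noncomputable def coxeterMatrix : CoxeterMatrix V where
  M := Matrix.of fun v w =>
    if v = w then 1 else if Γ.graph.Adj v w then Γ.label s(v, w) else 0
  isSymm := by
    ext v w
    simp only [Matrix.transpose_apply, Matrix.of_apply, eq_comm (a := w), Γ.graph.adj_comm w,
      Sym2.eq_swap (a := w)]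
  diagonal := by simp
  off_diagonal v w hvw := by
    by_cases h : Γ.graph.Adj v w
    · have := Γ.two_le_label s(v, w) h
      simp only [Matrix.of_apply, if_neg hvw, if_pos h]
      omega
    · simp [hvw, h]

/-- The Coxeter group `W_Γ`, generated by the vertices subject to `v ^ 2 = 1` for every vertex `v`
and `(v * w) ^ m = 1` for every edge with endpoints `v`, `w` and label `m`. Equivalently, it is the
quotient of the Artin group by the relations `v ^ 2 = 1`. -/
abbrev CoxeterGroup : Type _ := Γ.coxeterMatrix.Group

/-- `A_Γ` is of spherical type: the Coxeter group `W_Γ` is finite. -/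
def IsSphericalType : Prop := Finite Γ.CoxeterGroup

/-- `A_Γ` is of FC-type: for every clique `T` of `Γ`, the Artin group of the full subgraph `Γ_T` is
of spherical type. -/
def IsFCType : Prop := ∀ T : Set V, Γ.graph.IsClique T → (Γ.induce T).IsSphericalType

end LabelledGraph

/-- `H 0, …, H n` is a chain of subgroups `1 = H 0 ⊴ H 1 ⊴ ⋯ ⊴ H n = G` all of whose successive
quotients `H (i + 1) / H i` are free groups (of arbitrary, possibly infinite, rank). -/
def IsPolyFreeChain {G : Type*} [Group G] (n : ℕ) (H : ℕ → Subgroup G) : Prop :=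
  H 0 = ⊥ ∧ H n = ⊤ ∧ ∀ i < n, H i ≤ H (i + 1) ∧
    ∃ _ : ((H i).subgroupOf (H (i + 1))).Normal,
      IsFreeGroup (H (i + 1) ⧸ (H i).subgroupOf (H (i + 1)))

/-- A group is poly-free if it has a finite subnormal chain with free successive quotients. -/
def IsPolyFree (G : Type*) [Group G] : Prop :=
  ∃ (n : ℕ) (H : ℕ → Subgroup G), IsPolyFreeChain n H

/-- A group is normally poly-free if it has such a chain all of whose terms are normal in the whole
group. -/
def IsNormallyPolyFree (G : Type*) [Group G] : Prop :=
  ∃ (n : ℕ) (H : ℕ → Subgroup G), IsPolyFreeChain n H ∧ ∀ i ≤ n, (H i).Normal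

/-!
A group with a homomorphism to `Q` whose kernel is free inherits a (normal) chain with free
quotients from `Q`. Let `G` be generated by images of `A` and `B`, amalgamated along their
intersection, and let `π : G → Q` be injective on both. A Nielsen–Schreier argument shows that
`ker π` is free: the homomorphism `g ↦ (g, π g)` into the regular wreath product of `G` and `Q` is,
on the image of `A` and on that of `B`, conjugate to `g ↦ (1, π g)` by a function `Q → G`. Hence it
lifts to the wreath product of the free group on `G` and `Q`, and one coordinate of the lift embeds
`ker π` into the free group.

Since all labels are even, killing generators defines retractions `A_Γ → A_S`. If `v, w ∈ T` are not
adjacent, `A_T` is the amalgam of `A_{T ∖ v}` and `A_{T ∖ w}`, and the two retractions map it to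
their product, so everything reduces to cliques. For an edge with label `2k`, setting `c = vw` turns
the relation into `[v, c ^ k] = 1`: the dihedral Artin group is the amalgam of `⟨v, c ^ k⟩ ≅ ℤ²` and
`⟨c⟩ ≅ ℤ`, which the exponent sums map injectively to `ℤ²`. In FC-type, two edges of a clique with
labels greater than `2` never share a vertex, because the corresponding Coxeter group of rank three
is infinite. The Artin group of a clique is then a direct product of cyclic and dihedral ones.
-/

/-! ### Chains with free quotients -/

theorem isFreeGroup_of_injective {K : Type*} {F : Type*} [Group K] [Group F] [IsFreeGroup F]
    (φ : K →* F) (hφ : Function.Injective φ) : IsFreeGroup K :=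
  IsFreeGroup.ofMulEquiv (MonoidHom.ofInjective hφ).symm

theorem isFreeGroup_of_subsingleton (G : Type*) [Group G] [Subsingleton G] : IsFreeGroup G :=
  isFreeGroup_of_injective (1 : G →* FreeGroup Empty) (Function.injective_of_subsingleton _)

instance isFreeGroup_multiplicative_int : IsFreeGroup (Multiplicative ℤ) :=
  IsFreeGroup.ofMulEquiv (FreeGroup.mulEquivIntOfUnique : FreeGroup Unit ≃* Multiplicative ℤ)

section Chains

variable {normal : Prop} {G H K : Type*} [Group G] [Group H] [Group K]

/-- One step `A ⊴ B` of a chain, with free quotient `B / A`. If `normal` holds, then `A` and `B` are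
moreover required to be normal in the whole group; this parameter treats poly-free and normally
poly-free groups simultaneously. -/
def FreeStep (normal : Prop) (A B : Subgroup G) : Prop :=
  A ≤ B ∧ (∃ _ : (A.subgroupOf B).Normal, IsFreeGroup (B ⧸ A.subgroupOf B)) ∧
    (normal → A.Normal ∧ B.Normal)

theorem freeStep_of_hom [IsFreeGroup K] {A B : Subgroup G} (hAB : A ≤ B) (φ : B →* K)
    (hφ : φ.ker = A.subgroupOf B) (hnormal : normal → A.Normal ∧ B.Normal) :
    FreeStep normal A B := by
  refine ⟨hAB, ?_, hnormal⟩
  rw [← hφ]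
  exact ⟨inferInstance, isFreeGroup_of_injective (QuotientGroup.kerLift φ)
    (QuotientGroup.kerLift_injective φ)⟩

theorem FreeStep.inf_comap (f : G →* H) (N : Subgroup G) [N.Normal] {A B : Subgroup H}
    (h : FreeStep normal A B) : FreeStep normal (N ⊓ A.comap f) (N ⊓ B.comap f) := by
  obtain ⟨hAB, ⟨hnormal, hfree⟩, hAB_normal⟩ := h
  let g : (N ⊓ B.comap f : Subgroup G) →* B :=
    (f.comp (Subgroup.subtype _)).codRestrict B fun x => x.2.2
  refine freeStep_of_hom (inf_le_inf_left _ (Subgroup.comap_mono hAB))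
    ((QuotientGroup.mk' (A.subgroupOf B)).comp g) ?_ fun h => ?_
  · ext x
    have hx : (x : G) ∈ N := x.2.1
    have hg : ((g x : B) : H) = f x := rfl
    simp [MonoidHom.mem_ker, Subgroup.mem_subgroupOf, hx, hg]
  · obtain ⟨hA, hB⟩ := hAB_normal h
    exact ⟨inferInstance, inferInstance⟩

/-- A common name for poly-freeness (`normal = False`) and normal poly-freeness
(`normal = True`). -/
def HasFreeChain (normal : Prop) (G : Type*) [Group G] : Prop :=
  Relation.ReflTransGen (FreeStep normal) (⊥ : Subgroup G) ⊤

theorem HasFreeChain.reflTransGen_inf_ker (h : HasFreeChain normal H) (f : G →* H)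
    (N : Subgroup G) [N.Normal] : Relation.ReflTransGen (FreeStep normal) (N ⊓ f.ker) N := by
  have := Relation.ReflTransGen.lift (fun A : Subgroup H => N ⊓ A.comap f)
    (fun _ _ hAB => FreeStep.inf_comap f N hAB) _ _ h
  simpa [Function.onFun, MonoidHom.comap_bot] using this

theorem HasFreeChain.of_isFreeGroup_ker (h : HasFreeChain normal H) (f : G →* H)
    (hf : IsFreeGroup f.ker) : HasFreeChain normal G := by
  refine Relation.ReflTransGen.head ?_ (by simpa using h.reflTransGen_inf_ker f ⊤)
  refine freeStep_of_hom bot_le (MonoidHom.id f.ker) ?_ fun _ => ⟨inferInstance, inferInstance⟩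
  ext x
  simp

theorem HasFreeChain.of_injective (h : HasFreeChain normal H) (f : G →* H)
    (hf : Function.Injective f) : HasFreeChain normal G := by
  refine h.of_isFreeGroup_ker f ?_
  rw [(MonoidHom.ker_eq_bot_iff f).2 hf]
  exact isFreeGroup_of_subsingleton _

theorem HasFreeChain.prod (hG : HasFreeChain normal G) (hH : HasFreeChain normal H) :
    HasFreeChain normal (G × H) := by
  have hsnd := hH.reflTransGen_inf_ker (MonoidHom.snd G H) (MonoidHom.fst G H).ker
  have hfst := hG.reflTransGen_inf_ker (MonoidHom.fst G H) ⊤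
  have hbot : (MonoidHom.fst G H).ker ⊓ (MonoidHom.snd G H).ker = ⊥ := by
    ext x
    simp [Subgroup.mem_prod, Prod.ext_iff]
  rw [hbot] at hsnd
  rw [top_inf_eq] at hfst
  exact hsnd.trans hfst

theorem hasFreeChain_of_subsingleton (normal : Prop) (G : Type*) [Group G] [Subsingleton G] :
    HasFreeChain normal G := by
  rw [HasFreeChain, Subsingleton.elim (⊥ : Subgroup G) ⊤]

theorem hasFreeChain_of_isFreeGroup (normal : Prop) (G : Type*) [Group G] [IsFreeGroup G] :
    HasFreeChain normal G :=
  (hasFreeChain_of_subsingleton normal Unit).of_isFreeGroup_ker (1 : G →* Unit) inferInstance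

theorem reflTransGen_iff_exists_chain {α : Type*} (r : α → α → Prop) (x y : α) :
    Relation.ReflTransGen r x y ↔
      ∃ (n : ℕ) (c : ℕ → α), c 0 = x ∧ c n = y ∧ ∀ i < n, r (c i) (c (i + 1)) := by
  constructor
  · intro h
    induction h using Relation.ReflTransGen.head_induction_on with
    | refl => exact ⟨0, fun _ => y, rfl, rfl, by simp⟩
    | @head a _ hac _ ih =>
      obtain ⟨n, c, rfl, hn, hc⟩ := ih
      refine ⟨n + 1, fun i => Nat.casesOn i a c, rfl, hn, ?_⟩
      rintro (_ | i) hi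
      · exact hac
      · exact hc i (Nat.lt_of_succ_lt_succ hi)
  · rintro ⟨n, c, rfl, rfl, hc⟩
    induction n with
    | zero => exact .refl
    | succ n ih => exact (ih fun i hi => hc i (hi.trans n.lt_succ_self)).tail (hc n n.lt_succ_self)

theorem hasFreeChain_false_iff : HasFreeChain False G ↔ IsPolyFree G := by
  simp only [HasFreeChain, reflTransGen_iff_exists_chain, IsPolyFree, IsPolyFreeChain, FreeStep,
    false_imp_iff, and_true]

theorem hasFreeChain_true_iff : HasFreeChain True G ↔ IsNormallyPolyFree G := by
  simp only [HasFreeChain, reflTransGen_iff_exists_chain, IsNormallyPolyFree, IsPolyFreeChain,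
    FreeStep, true_imp_iff]
  refine exists₂_congr fun n c => ⟨fun ⟨h0, hn, h⟩ => ?_, fun ⟨⟨h0, hn, h⟩, hN⟩ => ?_⟩
  · refine ⟨⟨h0, hn, fun i hi => ⟨(h i hi).1, (h i hi).2.1⟩⟩, fun i hi => ?_⟩
    rcases hi.lt_or_eq with hi | rfl
    · exact (h i hi).2.2.1
    · rw [hn]
      infer_instance
  · exact ⟨h0, hn, fun i hi => ⟨(h i hi).1, (h i hi).2, hN i hi.le, hN (i + 1) hi⟩⟩

end Chains

/-! ### Amalgams -/

section Amalgam

variable {A B D D₁ D₂ G K Q : Type*} [Group A] [Group B] [Group D] [Group D₁] [Group D₂]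
  [Group G] [Group K] [Group Q]

/-- The conjugate, by a function `h : Q → D`, of the homomorphism `g ↦ (τ g, σ g)` into the regular
wreath product, where `τ g` stands for a constant function. -/
def wreathHom (σ : G →* Q) (τ : G →* D) (h : Q → D) : G →* D ≀ᵣ Q where
  toFun g := ⟨fun q => h q * τ g * (h ((σ g)⁻¹ * q))⁻¹, σ g⟩
  map_one' := by ext <;> simp
  map_mul' g g' := by ext <;> simp [mul_assoc]

theorem wreathHom_left (σ : G →* Q) (τ : G →* D) (h : Q → D) (g : G) (q : Q) :
    (wreathHom σ τ h g).left q = h q * τ g * (h ((σ g)⁻¹ * q))⁻¹ :=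
  rfl

theorem wreathHom_comp (σ : G →* Q) (τ : G →* D) (h : Q → D) (f : K →* G) :
    (wreathHom σ τ h).comp f = wreathHom (σ.comp f) (τ.comp f) h :=
  rfl

-- Conjugating by an equivariant section of `σ` makes the first coordinate trivial.
theorem wreathHom_mul_inv_of_equivariant {σ : G →* Q} {s : Q → G}
    (hs : ∀ g q, s (σ g * q) = g * s q) (τ : G →* D) (h : Q → D) :
    wreathHom σ τ (fun q => h q * (τ (s q))⁻¹) = wreathHom σ 1 h := by
  ext g q
  · have hsq : s ((σ g)⁻¹ * q) = g⁻¹ * s q := by rw [← map_inv, hs]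
    simp [wreathHom_left, hsq, mul_assoc]
  · rfl

/-- The homomorphism between regular wreath products that applies `ψ` to every coordinate. -/
def wreathMap (Q : Type*) [Group Q] (ψ : D₁ →* D₂) : D₁ ≀ᵣ Q →* D₂ ≀ᵣ Q where
  toFun x := ⟨fun q => ψ (x.left q), x.right⟩
  map_one' := by ext <;> simp
  map_mul' x y := by ext <;> simp

theorem wreathMap_left (ψ : D₁ →* D₂) (x : D₁ ≀ᵣ Q) (q : Q) :
    (wreathMap Q ψ x).left q = ψ (x.left q) :=
  rfl

theorem wreathMap_comp_wreathHom (ψ : D₁ →* D₂) (σ : G →* Q) (τ : G →* D₁) (h : Q → D₁) :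
    (wreathMap Q ψ).comp (wreathHom σ τ h) = wreathHom σ (ψ.comp τ) (ψ ∘ h) := by
  ext g
  · simp [wreathHom_left, wreathMap_left]
  · rfl

theorem isFreeGroup_ker_of_wreathMap_comp {F : Type*} [Group F] [IsFreeGroup F] {π : G →* Q}
    {θ : G →* F ≀ᵣ Q} {ψ : F →* G} {h : Q → G}
    (hθ : (wreathMap Q ψ).comp θ = wreathHom π (MonoidHom.id G) h) : IsFreeGroup π.ker := by
  have hright (k : π.ker) : (θ k).right = 1 :=
    (congrArg RegularWreathProduct.right (DFunLike.congr_fun hθ (k : G))).trans k.2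
  have hleft (k : π.ker) : ψ ((θ k).left 1) = h 1 * k * (h 1)⁻¹ := by
    have hk := congrFun (congrArg RegularWreathProduct.left (DFunLike.congr_fun hθ (k : G))) 1
    rw [wreathHom_left, k.2, inv_one, one_mul] at hk
    exact hk
  let φ : π.ker →* F := MonoidHom.mk' (fun k => (θ k).left 1) fun k l => by
    simp [hright k]
  refine isFreeGroup_of_injective φ fun k l hkl => Subtype.ext ?_
  have : h 1 * k * (h 1)⁻¹ = h 1 * l * (h 1)⁻¹ := by
    rw [← hleft, ← hleft]
    exact congrArg ψ hkl
  exact mul_left_cancel (mul_right_cancel this)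

theorem exists_equivariant_of_injective {σ : G →* Q} (hσ : Function.Injective σ) :
    ∃ s : Q → G, ∀ g q, s (σ g * q) = g * s q := by
  obtain ⟨T, hT, -⟩ := σ.range.exists_isComplement_right 1
  let e := MonoidHom.ofInjective hσ
  refine ⟨fun q => e.symm (hT.equiv q).1, fun g q => ?_⟩
  have hg : e.symm ⟨σ g, g, rfl⟩ = g := e.symm_apply_apply g
  dsimp only
  rw [hT.equiv_mul_left_of_mem ⟨g, rfl⟩, map_mul, hg]

/-- `G` is the amalgam of the images of `i` and `j`: it is generated by them, and homomorphisms on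
`A` and `B` that agree where `i` and `j` do extend to `G`. The universe `w` is that of the targets
of these homomorphisms. -/
structure IsAmalgam.{w, u, a, b} {A : Type a} {B : Type b} {G : Type u} [Group A] [Group B]
    [Group G] (i : A →* G) (j : B →* G) : Prop where
  sup_range_eq_top : i.range ⊔ j.range = ⊤
  exists_extension : ∀ {H : Type w} [Group H] (f : A →* H) (g : B →* H),
    (∀ a b, i a = j b → f a = g b) → ∃ φ : G →* H, φ.comp i = f ∧ φ.comp j = g

theorem hom_ext_of_sup_range_eq_top {i : A →* G} {j : B →* G} (hij : i.range ⊔ j.range = ⊤)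
    {f g : G →* K} (hi : f.comp i = g.comp i) (hj : f.comp j = g.comp j) : f = g := by
  refine MonoidHom.eq_of_eqOn_top (show (⊤ : Subgroup G) ≤ f.eqLocus g from ?_)
  rw [← hij, sup_le_iff]
  exact ⟨by rintro _ ⟨a, rfl⟩; exact DFunLike.congr_fun hi a,
    by rintro _ ⟨b, rfl⟩; exact DFunLike.congr_fun hj b⟩

end Amalgam

theorem IsAmalgam.isFreeGroup_ker.{u, v, a, b} {A : Type a} {B : Type b} {G : Type u} {Q : Type v}
    [Group A] [Group B] [Group G] [Group Q] {i : A →* G} {j : B →* G}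
    (h : IsAmalgam.{max u v} i j) (π : G →* Q) (hi : Function.Injective (π.comp i))
    (hj : Function.Injective (π.comp j)) : IsFreeGroup π.ker := by
  obtain ⟨s, hs⟩ := exists_equivariant_of_injective hi
  obtain ⟨t, ht⟩ := exists_equivariant_of_injective hj
  let d : Q → G := fun q => (i (s q))⁻¹ * j (t q)
  have hd {a b} (hab : i a = j b) (q : Q) : d ((π (i a))⁻¹ * q) = d q := by
    have hsq : s ((π (i a))⁻¹ * q) = a⁻¹ * s q := by
      rw [← map_inv, ← map_inv]; exact hs a⁻¹ q
    have htq : t ((π (i a))⁻¹ * q) = b⁻¹ * t q := by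
      rw [hab, ← map_inv, ← map_inv]; exact ht b⁻¹ q
    simp only [d, hsq, htq]
    rw [map_mul, map_mul, map_inv, map_inv, hab]
    group
  -- The lift on `A` is trivial and the one on `B` is conjugated by the letters `d q`; by `hd` they
  -- agree on the intersection.
  let ψ : FreeGroup G →* G := FreeGroup.lift id
  obtain ⟨θ, hθi, hθj⟩ := h.exists_extension (wreathHom (π.comp i) 1 1)
    (wreathHom (π.comp j) 1 (FreeGroup.of ∘ d)) fun a b hab => by
      ext q
      · simp [wreathHom_left, ← hab, hd hab]
      · exact congrArg π hab
  refine isFreeGroup_ker_of_wreathMap_comp (θ := θ) (ψ := ψ) (h := fun q => (i (s q))⁻¹)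
    (hom_ext_of_sup_range_eq_top h.sup_range_eq_top ?_ ?_)
  · rw [MonoidHom.comp_assoc, hθi, wreathMap_comp_wreathHom, wreathHom_comp]
    simpa using (wreathHom_mul_inv_of_equivariant hs i 1).symm
  · have hψd : ψ ∘ FreeGroup.of ∘ d = d := funext fun q => FreeGroup.lift_apply_of
    rw [MonoidHom.comp_assoc, hθj, wreathMap_comp_wreathHom, wreathHom_comp, hψd]
    simpa [d] using (wreathHom_mul_inv_of_equivariant ht j d).symm

theorem hom_ext_int_prod_int {M : Type*} [Group M]
    {f g : Multiplicative ℤ × Multiplicative ℤ →* M}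
    (hleft : f (Multiplicative.ofAdd 1, 1) = g (Multiplicative.ofAdd 1, 1))
    (hright : f (1, Multiplicative.ofAdd 1) = g (1, Multiplicative.ofAdd 1)) : f = g := by
  have hinl : f.comp (MonoidHom.inl _ _) = g.comp (MonoidHom.inl _ _) := MonoidHom.ext_mint hleft
  have hinr : f.comp (MonoidHom.inr _ _) = g.comp (MonoidHom.inr _ _) := MonoidHom.ext_mint hright
  rw [← f.noncommCoprod_unique, ← g.noncommCoprod_unique]
  simp only [hinl, hinr]

/-! ### Alternating products -/

theorem altProd_two_mul {M : Type*} [Monoid M] (k : ℕ) (v w : M) :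
    altProd (2 * k) v w = (v * w) ^ k := by
  induction k with
  | zero => simp [altProd]
  | succ k ih => rw [Nat.mul_succ, altProd, altProd, ih, pow_succ', mul_assoc]

theorem altProd_two_mul_comm {G : Type*} [Group G] {k : ℕ} {v w : G} :
    altProd (2 * k) v w = altProd (2 * k) w v ↔ Commute v ((v * w) ^ k) := by
  have h : (w * v) ^ k = v⁻¹ * (v * w) ^ k * v := by
    rw [show w * v = v⁻¹ * (v * w) * v⁻¹⁻¹ by group, conj_pow, inv_inv]
  rw [altProd_two_mul, altProd_two_mul, h, commute_iff_eq, mul_assoc, eq_inv_mul_iff_mul_eq]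

theorem map_altProd {M N : Type*} [Monoid M] [Monoid N] (f : M →* N) (m : ℕ) (v w : M) :
    f (altProd m v w) = altProd m (f v) (f w) := by
  induction m generalizing v w with
  | zero => exact map_one f
  | succ m ih => rw [altProd, altProd, map_mul, ih]

theorem altProd_one_left {M : Type*} [Monoid M] {m : ℕ} (hm : Even m) (w : M) :
    altProd m 1 w = altProd m w 1 := by
  obtain ⟨k, rfl⟩ := hm
  rw [← two_mul, altProd_two_mul, altProd_two_mul, one_mul, mul_one]

namespace LabelledGraph

/-! ### Even Artin groups and their retractions -/

variable {V : Type*} {Γ : LabelledGraph V} {H : Type*} [Group H] {S T : Set V} {v w : V}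

variable (Γ) in
/-- The standard generators of the Artin group. -/
def gen (v : V) : Γ.ArtinGroup :=
  PresentedGroup.of v

variable (Γ) in
/-- The universal property of the Artin group: a map on the vertices that respects the relations
extends to a homomorphism. -/
def artinLift (f : V → H)
    (hf : ∀ v w, Γ.graph.Adj v w →
      altProd (Γ.label s(v, w)) (f v) (f w) = altProd (Γ.label s(v, w)) (f w) (f v)) :
    Γ.ArtinGroup →* H :=
  PresentedGroup.toGroup (f := f) <| by
    rintro _ ⟨v, w, hvw, rfl⟩
    rw [map_mul, map_inv, map_altProd, map_altProd, FreeGroup.lift_apply_of,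
      FreeGroup.lift_apply_of, hf v w hvw, mul_inv_cancel]

theorem artinLift_gen (f : V → H)
    (hf : ∀ v w, Γ.graph.Adj v w →
      altProd (Γ.label s(v, w)) (f v) (f w) = altProd (Γ.label s(v, w)) (f w) (f v)) (v : V) :
    Γ.artinLift f hf (Γ.gen v) = f v :=
  PresentedGroup.toGroup.of _

theorem altProd_gen (h : Γ.graph.Adj v w) :
    altProd (Γ.label s(v, w)) (Γ.gen v) (Γ.gen w) =
      altProd (Γ.label s(v, w)) (Γ.gen w) (Γ.gen v) := by
  have := PresentedGroup.mk_eq_mk_of_mul_inv_mem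
    (show _ ∈ Γ.artinRels from ⟨v, w, h, rfl⟩)
  rwa [map_altProd, map_altProd] at this

theorem gen_mem (hv : v ∈ T) : Γ.gen v ∈ Γ.artinSubgroup T :=
  Subgroup.subset_closure ⟨v, hv, rfl⟩

theorem artinSubgroup_mono (h : S ⊆ T) : Γ.artinSubgroup S ≤ Γ.artinSubgroup T :=
  Subgroup.closure_mono (Set.image_mono h)

theorem artinSubgroup_univ : Γ.artinSubgroup Set.univ = ⊤ := by
  rw [artinSubgroup, Set.image_univ]
  exact PresentedGroup.closure_range_of _

theorem artinSubgroup_empty : Γ.artinSubgroup ∅ = ⊥ := by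
  rw [artinSubgroup, Set.image_empty, Subgroup.closure_empty]

theorem eq_top_of_gen_mem {K : Subgroup (Γ.artinSubgroup T)}
    (h : ∀ v (hv : v ∈ T), ⟨Γ.gen v, gen_mem hv⟩ ∈ K) : K = ⊤ := by
  refine top_unique (Subgroup.closure_closure_coe_preimage.ge.trans ((Subgroup.closure_le K).2 ?_))
  rintro ⟨_, _⟩ ⟨v, hv, rfl⟩
  exact h v hv

theorem artinSubgroup_hom_ext {f g : Γ.artinSubgroup T →* H}
    (h : ∀ v (hv : v ∈ T), f ⟨Γ.gen v, gen_mem hv⟩ = g ⟨Γ.gen v, gen_mem hv⟩) : f = g :=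
  MonoidHom.eq_of_eqOn_top fun x _ =>
    (eq_top_of_gen_mem (K := f.eqLocus g) h).ge (Subgroup.mem_top x)

theorem altProd_map_gen (f : Γ.artinSubgroup T →* H) (hv : v ∈ T) (hw : w ∈ T)
    (hvw : Γ.graph.Adj v w) :
    altProd (Γ.label s(v, w)) (f ⟨Γ.gen v, gen_mem hv⟩) (f ⟨Γ.gen w, gen_mem hw⟩) =
      altProd (Γ.label s(v, w)) (f ⟨Γ.gen w, gen_mem hw⟩) (f ⟨Γ.gen v, gen_mem hv⟩) := by
  rw [← map_altProd, ← map_altProd]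
  refine congrArg f (Subgroup.subtype_injective _ ?_)
  rw [map_altProd, map_altProd]
  exact altProd_gen hvw

open Classical in
/-- The homomorphism on an even Artin group that kills the generators outside of `S` and agrees with
`f` on `S`; only the relations between elements of `S` have to be checked. -/
noncomputable def partialLift (hΓ : Γ.IsEven) (S : Set V) (f : V → H)
    (hf : ∀ v ∈ S, ∀ w ∈ S, Γ.graph.Adj v w →
      altProd (Γ.label s(v, w)) (f v) (f w) = altProd (Γ.label s(v, w)) (f w) (f v)) :
    Γ.ArtinGroup →* H :=
  Γ.artinLift (fun v => if v ∈ S then f v else 1) <| by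
    intro v w hvw
    have heven := hΓ s(v, w) hvw
    by_cases hv : v ∈ S <;> by_cases hw : w ∈ S <;> simp only [hv, hw, if_true, if_false]
    · exact hf v hv w hw hvw
    · exact (altProd_one_left heven _).symm
    · exact altProd_one_left heven _

section partialLift

variable (hΓ : Γ.IsEven) {f : V → H} (hf : ∀ v ∈ S, ∀ w ∈ S, Γ.graph.Adj v w →
  altProd (Γ.label s(v, w)) (f v) (f w) = altProd (Γ.label s(v, w)) (f w) (f v))

theorem partialLift_gen_of_mem (hv : v ∈ S) : partialLift hΓ S f hf (Γ.gen v) = f v := by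
  rw [partialLift, artinLift_gen, if_pos hv]

theorem partialLift_gen_of_notMem (hv : v ∉ S) : partialLift hΓ S f hf (Γ.gen v) = 1 := by
  rw [partialLift, artinLift_gen, if_neg hv]

end partialLift

open Classical in
/-- The retraction of an even Artin group onto `A_S` that kills the generators outside of `S`. -/
noncomputable def retraction (hΓ : Γ.IsEven) (S : Set V) :
    Γ.ArtinGroup →* Γ.artinSubgroup S :=
  partialLift hΓ S (fun v => if hv : v ∈ S then ⟨Γ.gen v, gen_mem hv⟩ else 1)
    fun v hv w hw hvw => by
      simpa [hv, hw] using altProd_map_gen (MonoidHom.id _) hv hw hvw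

theorem retraction_gen_of_mem (hΓ : Γ.IsEven) (hv : v ∈ S) :
    retraction hΓ S (Γ.gen v) = ⟨Γ.gen v, gen_mem hv⟩ := by
  rw [retraction, partialLift_gen_of_mem hΓ _ hv, dif_pos hv]

theorem retraction_gen_of_notMem (hΓ : Γ.IsEven) (hv : v ∉ S) : retraction hΓ S (Γ.gen v) = 1 :=
  partialLift_gen_of_notMem hΓ _ hv

theorem retraction_comp_subtype (hΓ : Γ.IsEven) :
    (retraction hΓ S).comp (Γ.artinSubgroup S).subtype = MonoidHom.id _ :=
  artinSubgroup_hom_ext fun _ hv => retraction_gen_of_mem hΓ hv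

/-- The exponent sum of the generator `v`. -/
noncomputable def exponentSum (hΓ : Γ.IsEven) (v : V) : Γ.ArtinGroup →* Multiplicative ℤ :=
  partialLift hΓ {v} (fun _ => Multiplicative.ofAdd 1) fun _ _ _ _ _ => rfl

theorem exponentSum_self (hΓ : Γ.IsEven) (v : V) :
    exponentSum hΓ v (Γ.gen v) = Multiplicative.ofAdd 1 :=
  partialLift_gen_of_mem hΓ _ rfl

theorem exponentSum_of_ne (hΓ : Γ.IsEven) (h : w ≠ v) : exponentSum hΓ v (Γ.gen w) = 1 :=
  partialLift_gen_of_notMem hΓ _ h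

/-! ### Decompositions along non-adjacent vertices -/

theorem isAmalgam_inclusion.{w} (hΓ : Γ.IsEven)
    (hST : ∀ s ∈ S \ T, ∀ t ∈ T \ S, ¬ Γ.graph.Adj s t) :
    IsAmalgam.{w}
      (Subgroup.inclusion (artinSubgroup_mono (Γ := Γ) (S.subset_union_left (t := T))))
      (Subgroup.inclusion (artinSubgroup_mono (Γ := Γ) (S.subset_union_right (t := T)))) where
  sup_range_eq_top := eq_top_of_gen_mem fun v hv => hv.elim
    (fun hvS => Subgroup.mem_sup_left ⟨⟨Γ.gen v, gen_mem hvS⟩, rfl⟩)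
    (fun hvT => Subgroup.mem_sup_right ⟨⟨Γ.gen v, gen_mem hvT⟩, rfl⟩)
  exists_extension {H} _ f g hfg := by
    classical
    let F : V → H := fun v => if hv : v ∈ S then f ⟨Γ.gen v, gen_mem hv⟩ else
      if hv : v ∈ T then g ⟨Γ.gen v, gen_mem hv⟩ else 1
    have hF_S (v) (hv : v ∈ S) : F v = f ⟨Γ.gen v, gen_mem hv⟩ := dif_pos hv
    have hF_T (v) (hv : v ∈ T) : F v = g ⟨Γ.gen v, gen_mem hv⟩ := by
      by_cases hvS : v ∈ S
      · exact (hF_S v hvS).trans (hfg _ _ rfl)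
      · exact (dif_neg hvS).trans (dif_pos hv)
    have hF : ∀ v ∈ S ∪ T, ∀ w ∈ S ∪ T, Γ.graph.Adj v w →
        altProd (Γ.label s(v, w)) (F v) (F w) = altProd (Γ.label s(v, w)) (F w) (F v) := by
      intro v hv w hw hvw
      obtain ⟨hv, hw⟩ | ⟨hv, hw⟩ : (v ∈ S ∧ w ∈ S) ∨ (v ∈ T ∧ w ∈ T) := by
        have := hST v
        have := hST w
        have := hvw.symm
        grind
      · rw [hF_S v hv, hF_S w hw, altProd_map_gen f hv hw hvw]
      · rw [hF_T v hv, hF_T w hw, altProd_map_gen g hv hw hvw]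
    refine ⟨(partialLift hΓ (S ∪ T) F hF).comp (Subgroup.subtype _), ?_, ?_⟩
    · exact artinSubgroup_hom_ext fun v hv =>
        (partialLift_gen_of_mem hΓ hF (Or.inl hv)).trans (hF_S v hv)
    · exact artinSubgroup_hom_ext fun v hv =>
        (partialLift_gen_of_mem hΓ hF (Or.inr hv)).trans (hF_T v hv)

theorem hasFreeChain_artinSubgroup_union_of_not_adj (hΓ : Γ.IsEven) {normal : Prop}
    (hST : ∀ s ∈ S \ T, ∀ t ∈ T \ S, ¬ Γ.graph.Adj s t)
    (hS : HasFreeChain normal (Γ.artinSubgroup S)) (hT : HasFreeChain normal (Γ.artinSubgroup T)) :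
    HasFreeChain normal (Γ.artinSubgroup (S ∪ T)) := by
  let π := ((retraction hΓ S).prod (retraction hΓ T)).comp (Γ.artinSubgroup (S ∪ T)).subtype
  refine (hS.prod hT).of_isFreeGroup_ker π
    ((isAmalgam_inclusion hΓ hST).isFreeGroup_ker π (fun x y hxy => ?_) fun x y hxy => ?_)
  · have h (z) : retraction hΓ S (z : Γ.artinSubgroup S) = z :=
      DFunLike.congr_fun (retraction_comp_subtype hΓ) z
    exact (h x).symm.trans ((congrArg Prod.fst hxy).trans (h y))
  · have h (z) : retraction hΓ T (z : Γ.artinSubgroup T) = z :=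
      DFunLike.congr_fun (retraction_comp_subtype hΓ) z
    exact (h x).symm.trans ((congrArg Prod.snd hxy).trans (h y))

theorem hasFreeChain_of_isClique [Finite V] (hΓ : Γ.IsEven) {normal : Prop}
    (h : ∀ T : Set V, Γ.graph.IsClique T → HasFreeChain normal (Γ.artinSubgroup T)) :
    HasFreeChain normal Γ.ArtinGroup := by
  suffices key : ∀ T : Set V, HasFreeChain normal (Γ.artinSubgroup T) by
    refine (key Set.univ).of_injective ((MonoidHom.id _).codRestrict _ fun g => ?_) fun x y hxy =>
      congrArg Subtype.val hxy
    rw [artinSubgroup_univ]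
    trivial
  intro T
  induction T using WellFoundedLT.induction with
  | ind T ih =>
  by_cases hT : Γ.graph.IsClique T
  · exact h T hT
  · simp only [SimpleGraph.isClique_iff, Set.Pairwise, not_forall] at hT
    obtain ⟨v, hv, w, hw, hne, hvw⟩ := hT
    have hunion : T \ {v} ∪ T \ {w} = T := by grind
    have hdiff : ∀ s ∈ (T \ {v}) \ (T \ {w}), ∀ t ∈ (T \ {w}) \ (T \ {v}), ¬ Γ.graph.Adj s t := by
      have := mt SimpleGraph.Adj.symm hvw
      grind
    rw [← hunion]
    exact hasFreeChain_artinSubgroup_union_of_not_adj hΓ hdiff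
      (ih _ (Set.sdiff_singleton_ssubset.2 hv)) (ih _ (Set.sdiff_singleton_ssubset.2 hw))

/-! ### Dihedral and commuting pieces -/

theorem hasFreeChain_artinSubgroup_empty (normal : Prop) :
    HasFreeChain normal (Γ.artinSubgroup ∅) := by
  rw [artinSubgroup_empty]
  exact hasFreeChain_of_subsingleton normal _

theorem hasFreeChain_artinSubgroup_of_leftInverse {normal : Prop} (h : HasFreeChain normal H)
    (f : Γ.artinSubgroup T →* H) (g : H →* Γ.ArtinGroup)
    (hgf : ∀ v (hv : v ∈ T), g (f ⟨Γ.gen v, gen_mem hv⟩) = Γ.gen v) :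
    HasFreeChain normal (Γ.artinSubgroup T) := by
  have hcomp : g.comp f = (Γ.artinSubgroup T).subtype := artinSubgroup_hom_ext hgf
  refine h.of_injective f (Function.Injective.of_comp (f := g) ?_)
  rw [← MonoidHom.coe_comp, hcomp]
  exact Subgroup.subtype_injective _

theorem hasFreeChain_artinSubgroup_singleton (hΓ : Γ.IsEven) (normal : Prop) (v : V) :
    HasFreeChain normal (Γ.artinSubgroup {v}) := by
  refine hasFreeChain_artinSubgroup_of_leftInverse
    (hasFreeChain_of_isFreeGroup normal (Multiplicative ℤ))
    ((exponentSum hΓ v).comp (Subgroup.subtype _)) (zpowersHom _ (Γ.gen v)) ?_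
  rintro _ rfl
  simp [exponentSum_self]

theorem commute_of_mem (h : ∀ s ∈ S, ∀ t ∈ T, Commute (Γ.gen s) (Γ.gen t))
    {x y : Γ.ArtinGroup} (hx : x ∈ Γ.artinSubgroup S) (hy : y ∈ Γ.artinSubgroup T) :
    Commute x y := by
  have hle : Γ.artinSubgroup S ≤ Subgroup.centralizer (Γ.artinSubgroup T) := by
    rw [artinSubgroup, artinSubgroup, Subgroup.centralizer_closure, Subgroup.closure_le]
    rintro _ ⟨s, hs, rfl⟩ _ ⟨t, ht, rfl⟩
    exact (h s hs t ht).symm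
  exact (Subgroup.mem_centralizer_iff.1 (hle hx) y hy).symm

theorem hasFreeChain_artinSubgroup_union_of_commute (hΓ : Γ.IsEven) {normal : Prop}
    (hST : Disjoint S T)
    (h : ∀ s ∈ S, ∀ t ∈ T, Commute (Γ.gen s) (Γ.gen t))
    (hS : HasFreeChain normal (Γ.artinSubgroup S)) (hT : HasFreeChain normal (Γ.artinSubgroup T)) :
    HasFreeChain normal (Γ.artinSubgroup (S ∪ T)) := by
  let ρ := ((retraction hΓ S).prod (retraction hΓ T)).comp (Γ.artinSubgroup (S ∪ T)).subtype
  let μ := (Γ.artinSubgroup S).subtype.noncommCoprod (Γ.artinSubgroup T).subtype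
    fun x y => commute_of_mem h x.2 y.2
  refine hasFreeChain_artinSubgroup_of_leftInverse (hS.prod hT) ρ μ ?_
  rintro v (hv | hv)
  · simp [μ, ρ, retraction_gen_of_mem hΓ hv,
      retraction_gen_of_notMem hΓ (Set.disjoint_left.1 hST hv)]
  · simp [μ, ρ, retraction_gen_of_mem hΓ hv,
      retraction_gen_of_notMem hΓ (Set.disjoint_right.1 hST hv)]

theorem commute_gen_pow (h : Γ.graph.Adj v w) {k : ℕ} (hk : Γ.label s(v, w) = 2 * k) :
    Commute (Γ.gen v) ((Γ.gen v * Γ.gen w) ^ k) := by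
  have := altProd_gen h
  rwa [hk, altProd_two_mul_comm] at this

theorem exists_hom_gen_mul_gen (hΓ : Γ.IsEven) (hvw : Γ.graph.Adj v w) {k : ℕ}
    (hk : Γ.label s(v, w) = 2 * k) {p q : H} (h : Commute p (q ^ k)) :
    ∃ φ : Γ.ArtinGroup →* H, φ (Γ.gen v) = p ∧ φ (Γ.gen v * Γ.gen w) = q := by
  classical
  have hpq : altProd (Γ.label s(v, w)) p (p⁻¹ * q) = altProd (Γ.label s(v, w)) (p⁻¹ * q) p := by
    rwa [hk, altProd_two_mul_comm, mul_inv_cancel_left]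
  let φ := partialLift hΓ {v, w} (fun u => if u = v then p else p⁻¹ * q) <| by
    rintro _ (rfl | rfl) _ (rfl | rfl) _
    · rfl
    · simpa only [if_true, if_neg hvw.ne'] using hpq
    · simpa only [if_true, if_neg hvw.ne', Sym2.eq_swap] using hpq.symm
    · rfl
  have hφv : φ (Γ.gen v) = p := by
    rw [partialLift_gen_of_mem hΓ _ (Set.mem_insert v {w}), if_pos rfl]
  have hφw : φ (Γ.gen w) = p⁻¹ * q := by
    rw [partialLift_gen_of_mem hΓ _ (Set.mem_insert_of_mem v (Set.mem_singleton w)), if_neg hvw.ne']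
  exact ⟨φ, hφv, by rw [map_mul, hφv, hφw, mul_inv_cancel_left]⟩

theorem isAmalgam_zpowersHom.{w} (hΓ : Γ.IsEven) (hvw : Γ.graph.Adj v w) {k : ℕ}
    (hk : Γ.label s(v, w) = 2 * k) {a b : Γ.artinSubgroup {v, w}} (ha : a = Γ.gen v)
    (hb : b = Γ.gen w) (hcomm : ∀ m n, Commute (zpowersHom _ a m) (zpowersHom _ ((a * b) ^ k) n)) :
    IsAmalgam.{w} ((zpowersHom _ a).noncommCoprod (zpowersHom _ ((a * b) ^ k)) hcomm)
      (zpowersHom _ (a * b)) where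
  sup_range_eq_top := by
    set i := (zpowersHom _ a).noncommCoprod (zpowersHom _ ((a * b) ^ k)) hcomm
    set j := zpowersHom _ (a * b)
    have ha_mem : a ∈ i.range ⊔ j.range :=
      Subgroup.mem_sup_left ⟨(Multiplicative.ofAdd 1, 1), by simp [i]⟩
    have hab_mem : a * b ∈ i.range ⊔ j.range :=
      Subgroup.mem_sup_right ⟨Multiplicative.ofAdd 1, by simp [j]⟩
    refine eq_top_of_gen_mem ?_
    rintro _ (rfl | rfl)
    · convert ha_mem
      exact ha.symm
    · convert (Subgroup.mul_mem_cancel_left _ ha_mem).1 hab_mem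
      exact hb.symm
  exists_extension {H} _ f g hfg := by
    have hqk : f (1, Multiplicative.ofAdd 1) = g (Multiplicative.ofAdd 1) ^ k := by
      rw [← map_pow]
      exact hfg _ _ (by simp)
    obtain ⟨φ, hφa, hφab⟩ := exists_hom_gen_mul_gen (p := f (Multiplicative.ofAdd 1, 1))
      (q := g (Multiplicative.ofAdd 1)) hΓ hvw hk (hqk ▸ (MonoidHom.commute_inl_inr _ _).map f)
    rw [← ha] at hφa
    rw [← ha, ← hb, map_mul] at hφab
    refine ⟨φ.comp (Subgroup.subtype _), hom_ext_int_prod_int ?_ ?_, MonoidHom.ext_mint ?_⟩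
    · simpa using hφa
    · simpa [hφab] using hqk.symm
    · simpa using hφab

theorem hasFreeChain_artinSubgroup_pair (hΓ : Γ.IsEven) (normal : Prop)
    (hvw : Γ.graph.Adj v w) : HasFreeChain normal (Γ.artinSubgroup {v, w}) := by
  obtain ⟨k, hk⟩ := (hΓ s(v, w) hvw).two_dvd
  have hk0 : (k : ℤ) ≠ 0 := by
    have := Γ.two_le_label s(v, w) hvw
    omega
  let a : Γ.artinSubgroup {v, w} := ⟨Γ.gen v, gen_mem (by simp)⟩
  let b : Γ.artinSubgroup {v, w} := ⟨Γ.gen w, gen_mem (by simp)⟩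
  have hab : Commute a ((a * b) ^ k) := Subtype.ext (commute_gen_pow hvw hk)
  have hfree := hasFreeChain_of_isFreeGroup normal (Multiplicative ℤ)
  let π := ((exponentSum hΓ v).prod (exponentSum hΓ w)).comp (Γ.artinSubgroup {v, w}).subtype
  have hπa : π a = (Multiplicative.ofAdd 1, 1) :=
    Prod.ext (exponentSum_self hΓ v) (exponentSum_of_ne hΓ hvw.ne)
  have hπb : π b = (1, Multiplicative.ofAdd 1) :=
    Prod.ext (exponentSum_of_ne hΓ hvw.ne') (exponentSum_self hΓ w)
  have hπi (m n : ℤ) : π (a ^ m * ((a * b) ^ k) ^ n) =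
      (Multiplicative.ofAdd (m + k * n), Multiplicative.ofAdd (k * n)) := by
    refine Prod.ext (Multiplicative.toAdd.injective ?_) (Multiplicative.toAdd.injective ?_) <;>
      simp [hπa, hπb, mul_comm]
  have hπj (n : ℤ) : π ((a * b) ^ n) = (Multiplicative.ofAdd n, Multiplicative.ofAdd n) := by
    simp [hπa, hπb, ← ofAdd_zsmul]
  refine (hfree.prod hfree).of_isFreeGroup_ker π
    ((isAmalgam_zpowersHom hΓ hvw hk (a := a) (b := b) rfl rfl
      fun m n => hab.zpow_zpow m.toAdd n.toAdd).isFreeGroup_ker π ?_ ?_)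
  · rintro ⟨m, n⟩ ⟨m', n'⟩ h
    obtain ⟨hm, hn⟩ := Prod.ext_iff.1 ((hπi _ _).symm.trans (h.trans (hπi _ _)))
    have hn : n = n' := mul_left_cancel₀ (M₀ := ℤ) hk0 (Multiplicative.ofAdd.injective hn)
    subst hn
    exact Prod.ext (add_right_cancel (G := ℤ) (Multiplicative.ofAdd.injective hm)) rfl
  · intro n n' h
    exact congrArg Prod.fst ((hπj _).symm.trans (h.trans (hπj _)))

end LabelledGraph

/-! ### Infinite Coxeter groups of rank three -/

theorem reflection_mul_reflection_pow_two_mul {M : Type*} [AddCommGroup M] [Module ℝ M]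
    {x y : M} {f g : Module.Dual ℝ M} (hf : f x = 2) (hg : g y = 2) {k : ℕ} (hk : 2 ≤ k)
    (h : f y * g x = 2 + 2 * Real.cos (Real.pi / k)) :
    (Module.reflection hf * Module.reflection hg) ^ (2 * k) = 1 := by
  have hk' : (2 : ℝ) ≤ k := by exact_mod_cast hk
  have hsin : 0 < Real.sin (Real.pi / k) :=
    Real.sin_pos_of_pos_of_lt_pi (by positivity) (div_lt_self Real.pi_pos (by linarith))
  have hS : (Polynomial.Chebyshev.S ℝ ((k : ℤ) - 1)).eval (2 * Real.cos (Real.pi / k)) = 0 := by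
    have := Polynomial.Chebyshev.S_two_mul_real_cos (Real.pi / k) ((k : ℤ) - 1)
    rw [show (((k : ℤ) - 1 : ℤ) : ℝ) + 1 = k by push_cast; ring,
      mul_div_cancel₀ _ (by positivity), Real.sin_pi] at this
    exact (mul_eq_zero.1 this).resolve_right hsin.ne'
  ext z
  rw [Module.reflection_mul_reflection_pow_apply hf hg (2 * k) z (2 * Real.cos (Real.pi / k))
    (by rw [h]; ring), show (((2 * k : ℕ) : ℤ) - 2) / 2 = k - 1 by omega,
    show (((2 * k : ℕ) : ℤ) - 1) / 2 = k - 1 by omega, hS]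
  simp

section CartanReflection

variable {ι : Type*} [Fintype ι] [DecidableEq ι] {C : Matrix ι ι ℝ} (hC : ∀ i, C i i = 2)

/-- The `i`-th reflection `z ↦ z - (C z)ᵢ eᵢ` defined by a generalized Cartan matrix `C`. -/
noncomputable def cartanReflection (i : ι) : (ι → ℝ) ≃ₗ[ℝ] (ι → ℝ) :=
  Module.reflection (x := Pi.single i 1) (f := LinearMap.proj i ∘ₗ C.mulVecLin) (by simp [hC])

theorem cartanReflection_apply (i : ι) (z : ι → ℝ) :
    cartanReflection hC i z = z - (C.mulVec z) i • Pi.single i 1 :=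
  rfl

theorem cartanReflection_mul_self (i : ι) : cartanReflection hC i * cartanReflection hC i = 1 :=
  LinearEquiv.ext (Module.involutive_reflection _)

theorem cartanReflection_mul_pow_two_mul {i j : ι} {k : ℕ} (hk : 2 ≤ k)
    (h : C i j * C j i = 2 + 2 * Real.cos (Real.pi / k)) :
    (cartanReflection hC i * cartanReflection hC j) ^ (2 * k) = 1 :=
  reflection_mul_reflection_pow_two_mul _ _ hk (by simpa using h)

theorem commute_cartanReflection {i j : ι} (hij : C i j = 0) (hji : C j i = 0) :
    Commute (cartanReflection hC i) (cartanReflection hC j) := by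
  refine LinearEquiv.ext fun z => ?_
  simp only [LinearEquiv.mul_apply, cartanReflection_apply, Matrix.mulVec_sub, Matrix.mulVec_smul,
    Matrix.mulVec_single_one, Pi.sub_apply, Pi.smul_apply, Matrix.col_apply, hij, hji,
    smul_zero, sub_zero]
  abel

end CartanReflection

/-- The generalized Cartan matrix of a path with three vertices; over an edge with Coxeter label `m`
the entries have product `4 * cos (π / m) ^ 2`, here `A` and `B`. -/
def pathCartan (A B : ℝ) : Matrix (Fin 3) (Fin 3) ℝ :=
  !![2, -A, 0; -1, 2, -1; 0, -B, 2]

theorem pathCartan_diag (A B : ℝ) (i : Fin 3) : pathCartan A B i i = 2 := by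
  fin_cases i <;> rfl

/-- The reflections of `pathCartan A B`. -/
noncomputable abbrev pathReflection (A B : ℝ) : Fin 3 → ((Fin 3 → ℝ) ≃ₗ[ℝ] (Fin 3 → ℝ)) :=
  cartanReflection (pathCartan_diag A B)

theorem pathReflection_mul_mul_apply (A B : ℝ) (z : Fin 3 → ℝ) :
    (pathReflection A B 0 * pathReflection A B 2 * pathReflection A B 1) z =
      ![A * (z 0 + z 2 - z 1) - z 0, z 0 + z 2 - z 1, B * (z 0 + z 2 - z 1) - z 2] := by
  have h (i j : Fin 3) (z : Fin 3 → ℝ) : pathReflection A B i z j =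
      z j - (pathCartan A B i 0 * z 0 + pathCartan A B i 1 * z 1 + pathCartan A B i 2 * z 2) *
        Pi.single (M := fun _ => ℝ) i 1 j := by
    rw [cartanReflection_apply]
    simp [Matrix.mulVec, dotProduct, Fin.sum_univ_three]
  ext j
  simp only [LinearEquiv.mul_apply, h]
  fin_cases j <;> simp [pathCartan] <;> ring

theorem not_isOfFinOrder_pathReflection_mul_mul {A B : ℝ} (hAB : 4 ≤ A + B) :
    ¬ IsOfFinOrder (pathReflection A B 0 * pathReflection A B 2 * pathReflection A B 1) := by
  set r := pathReflection A B 0 * pathReflection A B 2 * pathReflection A B 1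
  have key (n : ℕ) : (n : ℝ) ≤ (r ^ n) ![1, 0, 0] 1 ∧
      2 * (r ^ n) ![1, 0, 0] 1 + 1 ≤ (r ^ n) ![1, 0, 0] 0 + (r ^ n) ![1, 0, 0] 2 := by
    induction n with
    | zero => simp
    | succ n ih =>
      rw [pow_succ', LinearEquiv.mul_apply, pathReflection_mul_mul_apply]
      generalize (r ^ n) ![1, 0, 0] = z at ih
      obtain ⟨hn, hz⟩ := ih
      have : 4 * (z 0 + z 2 - z 1) ≤ (A + B) * (z 0 + z 2 - z 1) :=
        mul_le_mul_of_nonneg_right hAB (by linarith [n.cast_nonneg (α := ℝ)])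
      simp only [Nat.cast_succ, Matrix.cons_val]
      constructor <;> linarith
  rw [isOfFinOrder_iff_pow_eq_one]
  rintro ⟨n, hn, h⟩
  have hle := (key n).1
  rw [h] at hle
  exact hn.ne' (Nat.cast_nonpos.1 hle)

theorem isLiftable_of_lt {ι G : Type*} [LinearOrder ι] [Group G] {M : CoxeterMatrix ι} {f : ι → G}
    (hself : ∀ i, f i * f i = 1) (hlt : ∀ i j, i < j → (f i * f j) ^ M i j = 1) :
    M.IsLiftable f := by
  have hswap (i j) : f j * f i = (f i * f j)⁻¹ := by
    rw [mul_inv_rev, ← eq_inv_of_mul_eq_one_left (hself i), ← eq_inv_of_mul_eq_one_left (hself j)]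
  intro i j
  rcases lt_trichotomy i j with hij | rfl | hij
  · exact hlt i j hij
  · rw [M.diagonal, pow_one, hself]
  · rw [hswap, inv_pow, M.symmetric, hlt j i hij, inv_one]

theorem two_le_two_add_two_mul_cos_pi_div {n : ℕ} (hn : 2 ≤ n) :
    2 ≤ 2 + 2 * Real.cos (Real.pi / n) := by
  have hn' : (2 : ℝ) ≤ n := by exact_mod_cast hn
  have : 0 ≤ Real.cos (Real.pi / n) := Real.cos_nonneg_of_neg_pi_div_two_le_of_le
    ((neg_nonpos.2 (by positivity)).trans (by positivity))
    (div_le_div_of_nonneg_left Real.pi_pos.le two_pos hn')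
  linarith

theorem infinite_coxeterGroup_of_even {M : CoxeterMatrix (Fin 3)} {k l : ℕ} (hk : 2 ≤ k)
    (hl : 2 ≤ l) (h01 : M 0 1 = 2 * k) (h12 : M 1 2 = 2 * l) (h02 : Even (M 0 2)) :
    Infinite M.Group := by
  let A := 2 + 2 * Real.cos (Real.pi / k)
  let B := 2 + 2 * Real.cos (Real.pi / l)
  have hAB : 4 ≤ A + B := by
    linarith [two_le_two_add_two_mul_cos_pi_div hk, two_le_two_add_two_mul_cos_pi_div hl]
  have hcomm : Commute (pathReflection A B 0) (pathReflection A B 2) :=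
    commute_cartanReflection _ rfl rfl
  have hlift : M.IsLiftable (pathReflection A B) := by
    refine isLiftable_of_lt (cartanReflection_mul_self _) fun i j hij => ?_
    obtain ⟨rfl, rfl⟩ | ⟨rfl, rfl⟩ | ⟨rfl, rfl⟩ :
      (i = 0 ∧ j = 1) ∨ (i = 1 ∧ j = 2) ∨ (i = 0 ∧ j = 2) := by omega
    · rw [h01]
      exact cartanReflection_mul_pow_two_mul _ hk (by simp [pathCartan, A])
    · rw [h12]
      exact cartanReflection_mul_pow_two_mul _ hl (by simp [pathCartan, B])
    · obtain ⟨m, hm⟩ := h02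
      rw [hm, ← two_mul, pow_mul, hcomm.mul_pow, pow_two, pow_two, cartanReflection_mul_self,
        cartanReflection_mul_self, one_mul, one_pow]
  refine not_finite_iff_infinite.1 fun _ => not_isOfFinOrder_pathReflection_mul_mul hAB ?_
  let φ := M.toCoxeterSystem.lift ⟨_, hlift⟩
  have hφ (i : Fin 3) : φ (M.simple i) = pathReflection A B i :=
    M.toCoxeterSystem.lift_apply_simple hlift i
  rw [← hφ, ← hφ, ← hφ, ← map_mul, ← map_mul]
  exact φ.isOfFinOrder (isOfFinOrder_of_finite _)

namespace LabelledGraph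

/-! ### Even Artin groups of FC-type -/

variable {V : Type*} {Γ : LabelledGraph V} {S T : Set V} {s t u v w : V}

theorem coxeterMatrix_apply_of_adj (h : Γ.graph.Adj v w) :
    Γ.coxeterMatrix v w = Γ.label s(v, w) := by
  classical
  change (if v = w then 1 else if Γ.graph.Adj v w then Γ.label s(v, w) else 0) = _
  rw [if_neg h.ne, if_pos h]

theorem IsFCType.label_eq_two_or (hΓ : Γ.IsEven) (hFC : Γ.IsFCType)
    (hst : Γ.graph.Adj s t) (htu : Γ.graph.Adj t u) (hsu : Γ.graph.Adj s u) :
    Γ.label s(s, t) = 2 ∨ Γ.label s(t, u) = 2 := by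
  by_contra! hne
  obtain ⟨k, hk⟩ := (hΓ s(s, t) hst).two_dvd
  obtain ⟨l, hl⟩ := (hΓ s(t, u) htu).two_dvd
  have hk2 : 2 ≤ k := by
    have := Γ.two_le_label s(s, t) hst
    omega
  have hl2 : 2 ≤ l := by
    have := Γ.two_le_label s(t, u) htu
    omega
  have hinj : Function.Injective ![s, t, u] := by
    intro i j
    fin_cases i <;> fin_cases j <;> simp [hst.ne, hst.ne', htu.ne, htu.ne', hsu.ne, hsu.ne']
  have hclique : Γ.graph.IsClique (Set.range ![s, t, u]) := by
    simp [Matrix.range_cons, SimpleGraph.isClique_insert, hst.symm, htu.symm, hsu.symm]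
  let M := (Γ.induce (Set.range ![s, t, u])).coxeterMatrix.reindex (Equiv.ofInjective _ hinj).symm
  have hM (i j : Fin 3) (hij : Γ.graph.Adj (![s, t, u] i) (![s, t, u] j)) :
      M i j = Γ.label s(![s, t, u] i, ![s, t, u] j) :=
    coxeterMatrix_apply_of_adj (Γ := Γ.induce (Set.range ![s, t, u])) hij
  have hinf : Infinite M.Group := infinite_coxeterGroup_of_even hk2 hl2
    ((hM 0 1 hst).trans hk) ((hM 1 2 htu).trans hl) (hM 0 2 hsu ▸ hΓ s(s, u) hsu)
  have : Finite (Γ.induce (Set.range ![s, t, u])).CoxeterGroup := hFC _ hclique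
  exact hinf.not_finite (Finite.of_equiv _ (CoxeterMatrix.reindexGroupEquiv _ _).symm.toEquiv)

theorem commute_gen (h : Γ.graph.Adj v w) (h2 : Γ.label s(v, w) = 2) :
    Commute (Γ.gen v) (Γ.gen w) := by
  have := commute_gen_pow (k := 1) h h2
  rwa [pow_one, commute_iff_eq, ← mul_assoc, mul_assoc, mul_assoc, mul_right_inj] at this

theorem exists_hasFreeChain_subset (hΓ : Γ.IsEven) (normal : Prop) (hT : Γ.graph.IsClique T)
    (hne : T.Nonempty)
    (h : ∀ s ∈ T, ∀ t ∈ T, ∀ u ∈ T, s ≠ t → t ≠ u → s ≠ u →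
      Γ.label s(s, t) = 2 ∨ Γ.label s(t, u) = 2) :
    ∃ S ⊆ T, S.Nonempty ∧ HasFreeChain normal (Γ.artinSubgroup S) ∧
      ∀ s ∈ S, ∀ t ∈ T \ S, Γ.label s(s, t) = 2 := by
  by_cases hall : ∀ v ∈ T, ∀ w ∈ T, v ≠ w → Γ.label s(v, w) = 2
  · obtain ⟨v, hv⟩ := hne
    refine ⟨{v}, Set.singleton_subset_iff.2 hv, Set.singleton_nonempty v,
      hasFreeChain_artinSubgroup_singleton hΓ normal v, ?_⟩
    rintro _ rfl t ⟨ht, hts⟩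
    exact hall _ hv t ht (Ne.symm hts)
  · push Not at hall
    obtain ⟨v, hv, w, hw, hvw, h2⟩ := hall
    refine ⟨{v, w}, Set.pair_subset hv hw, Set.insert_nonempty v _,
      hasFreeChain_artinSubgroup_pair hΓ normal (hT hv hw hvw), ?_⟩
    rintro s hs t ⟨ht, hts⟩
    simp only [Set.mem_insert_iff, Set.mem_singleton_iff, not_or] at hts
    rcases hs with rfl | rfl
    · rw [Sym2.eq_swap]
      exact (h t ht _ hv _ hw hts.1 hvw hts.2).resolve_right h2
    · exact (h v hv _ hw t ht hvw (Ne.symm hts.2) (Ne.symm hts.1)).resolve_left h2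

theorem hasFreeChain_artinSubgroup_of_isClique [Finite V] (hΓ : Γ.IsEven) (normal : Prop)
    (hT : Γ.graph.IsClique T)
    (h : ∀ s ∈ T, ∀ t ∈ T, ∀ u ∈ T, s ≠ t → t ≠ u → s ≠ u →
      Γ.label s(s, t) = 2 ∨ Γ.label s(t, u) = 2) :
    HasFreeChain normal (Γ.artinSubgroup T) := by
  induction T using WellFoundedLT.induction with
  | ind T ih =>
  rcases T.eq_empty_or_nonempty with rfl | hne
  · exact hasFreeChain_artinSubgroup_empty normal
  obtain ⟨S, hST, hS, hchain, h2⟩ := exists_hasFreeChain_subset hΓ normal hT hne h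
  have hcomm : ∀ s ∈ S, ∀ t ∈ T \ S, Commute (Γ.gen s) (Γ.gen t) := fun s hs t ht =>
    commute_gen (hT (hST hs) ht.1 (ne_of_mem_of_not_mem hs ht.2)) (h2 s hs t ht)
  rw [← Set.union_sdiff_cancel hST]
  refine hasFreeChain_artinSubgroup_union_of_commute hΓ Set.disjoint_sdiff_right hcomm hchain
    (ih _ ?_ (hT.subset Set.sdiff_subset) ?_)
  · exact hST.sdiff_ssubset_of_nonempty hS
  · exact fun s hs t ht u hu => h s hs.1 t ht.1 u hu.1

theorem IsFCType.hasFreeChain (hΓ : Γ.IsEven) (hFC : Γ.IsFCType) [Finite V] (normal : Prop) :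
    HasFreeChain normal Γ.ArtinGroup :=
  hasFreeChain_of_isClique hΓ fun _ hT => hasFreeChain_artinSubgroup_of_isClique hΓ normal hT
    fun _ hs _ ht _ hu hst htu hsu => hFC.label_eq_two_or hΓ (hT hs ht hst) (hT ht hu htu)
      (hT hs hu hsu)

end LabelledGraph

theorem theoremA {V : Type*} [Finite V] (Γ : LabelledGraph V) (hΓ : Γ.IsEven) :
    (Γ.IsFCType → IsNormallyPolyFree Γ.ArtinGroup) ∧
    ((∀ T : Set V, Γ.graph.IsClique T → IsPolyFree (Γ.artinSubgroup T)) →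
      IsPolyFree Γ.ArtinGroup) ∧
    ((∀ T : Set V, Γ.graph.IsClique T → IsNormallyPolyFree (Γ.artinSubgroup T)) →
      IsNormallyPolyFree Γ.ArtinGroup) := by
  simp only [← hasFreeChain_true_iff, ← hasFreeChain_false_iff]
  exact ⟨fun hFC => hFC.hasFreeChain hΓ True,
    LabelledGraph.hasFreeChain_of_isClique hΓ, LabelledGraph.hasFreeChain_of_isClique hΓ⟩
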